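/- Let $\mathbb{H}$ be the real quaternions with units $\mathbf i,\mathbf j,\mathbf k$. For a quaternionic $3\times 3$ matrix $A=A_1+A_2\mathbf{j}$ with $A_1,A_2\in \mathrm{M}(3,\mathbb{C})$, put $$\Phi(A)=\begin{pmatrix}A_1&A_2\\-\overline{A_2}&\overline{A_1}\end{pmatrix}\in \mathrm{M}(6,\mathbb{C}),\qquad \det\nolimits_{\mathbb H}(A)=\det\Phi(A),$$ and let $\mathrm{SL}(3,\mathbb{H})$ be the group of quaternionic $3\times3$ matrices $A$ with $\det_{\mathbb H}(A)=1$. An element of $\mathrm{SL}(3,\mathbb{H})$ is called simple if it is conjugate in $\mathrm{SL}(3,\mathbb{H})$ to an element of $\mathrm{SL}(3,\mathbb{R})$, that is, to a matrix with real entries and (real) determinant $1$. Theorem. Every element of $\mathrm{SL}(3,\mathbb{H})$ is a product of four simple elements of $\mathrm{SL}(3,\mathbb{H})$. Moreover, if $A\in\mathrm{SL}(3,\mathbb{H})$ has, for some $\theta,\phi,\psi\in[0,\pi]$, one of the Jordan forms (that is, is conjugate by an invertible quaternionic matrix to one of) $$\begin{pmatrix}e^{\mathbf i\theta}&0&0\\0&e^{\mathbf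 i\phi}&0\\0&0&e^{\mathbf i\psi}\end{pmatrix},\qquad \begin{pmatrix}e^{\mathbf i\theta}&1&0\\0&e^{\mathbf i\theta}&0\\0&0&e^{\mathbf i\psi}\end{pmatrix},$$ then $A$ is a product of three simple elements. -/

import Mathlib

open scoped Quaternion

noncomputable section

namespace QuatSL

/-- The complex number `z` in the decomposition `q = z + w j` of a quaternion, `z, w ∈ ℂ`. -/
def fstPart (q : ℍ) : ℂ := ⟨q.re, q.imI⟩

/-- The complex number `w` in the decomposition `q = z + w j` of a quaternion, `z, w ∈ ℂ`. -/
def sndPart (q : ℍ) : ℂ := ⟨q.imJ, q.imK⟩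

/-- The complex adjoint matrix of `A = A₁ + A₂ j`, namely the block matrix with rows
`(A₁, A₂)` and `(- conj A₂, conj A₁)`. -/
def complexAdjoint {n : ℕ} (A : Matrix (Fin n) (Fin n) ℍ) :
    Matrix (Fin n ⊕ Fin n) (Fin n ⊕ Fin n) ℂ :=
  Matrix.fromBlocks (A.map fstPart) (A.map sndPart)
    (-(A.map fun q => star (sndPart q))) (A.map fun q => star (fstPart q))

/-- The quaternionic determinant: the determinant of the complex adjoint matrix. -/
def detH {n : ℕ} (A : Matrix (Fin n) (Fin n) ℍ) : ℂ := (complexAdjoint A).det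

theorem fstPart_sum {ι : Type*} (s : Finset ι) (f : ι → ℍ) :
    fstPart (∑ i ∈ s, f i) = ∑ i ∈ s, fstPart (f i) :=
  map_sum (⟨⟨fstPart, rfl⟩, fun _ _ => rfl⟩ : ℍ →+ ℂ) f s

theorem sndPart_sum {ι : Type*} (s : Finset ι) (f : ι → ℍ) :
    sndPart (∑ i ∈ s, f i) = ∑ i ∈ s, sndPart (f i) :=
  map_sum (⟨⟨sndPart, rfl⟩, fun _ _ => rfl⟩ : ℍ →+ ℂ) f s

theorem fstPart_mul (p q : ℍ) :
    fstPart (p * q) = fstPart p * fstPart q - sndPart p * star (sndPart q) := by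
  apply Complex.ext <;> simp [fstPart, sndPart] <;> ring

theorem sndPart_mul (p q : ℍ) :
    sndPart (p * q) = fstPart p * sndPart q + sndPart p * star (fstPart q) := by
  apply Complex.ext <;> simp [fstPart, sndPart] <;> ring

theorem complexAdjoint_one {n : ℕ} : complexAdjoint (1 : Matrix (Fin n) (Fin n) ℍ) = 1 := by
  ext i j
  rcases i with i | i <;> rcases j with j | j <;> by_cases h : i = j <;>
    simp [complexAdjoint, Matrix.one_apply, h, fstPart, sndPart, Complex.ext_iff]

theorem complexAdjoint_mul {n : ℕ} (A B : Matrix (Fin n) (Fin n) ℍ) :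
    complexAdjoint (A * B) = complexAdjoint A * complexAdjoint B := by
  simp only [complexAdjoint]
  rw [Matrix.fromBlocks_multiply]
  congr 1 <;> ext i j : 2 <;>
    simp only [Matrix.add_apply, Matrix.mul_apply, Matrix.map_apply, Matrix.neg_apply,
      fstPart_sum, sndPart_sum, star_sum, ← Finset.sum_add_distrib, ← Finset.sum_neg_distrib] <;>
    refine Finset.sum_congr rfl fun k _ => ?_ <;>
    simp only [fstPart_mul, sndPart_mul, star_sub, star_add, star_mul', star_star] <;> ring

theorem complexAdjoint_injective {n : ℕ} :
    Function.Injective (complexAdjoint : Matrix (Fin n) (Fin n) ℍ → _) := by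
  intro A B h
  refine Matrix.ext fun i j => ?_
  have h1 : fstPart (A i j) = fstPart (B i j) := congrFun₂ h (Sum.inl i) (Sum.inl j)
  have h2 : sndPart (A i j) = sndPart (B i j) := congrFun₂ h (Sum.inl i) (Sum.inr j)
  exact QuaternionAlgebra.ext (congrArg Complex.re h1) (congrArg Complex.im h1)
    (congrArg Complex.re h2) (congrArg Complex.im h2)

/-- The quaternionic determinant as a monoid homomorphism. -/
def detHHom (n : ℕ) : Matrix (Fin n) (Fin n) ℍ →* ℂ where
  toFun := detH
  map_one' := by simp [detH, complexAdjoint_one]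
  map_mul' A B := by simp [detH, complexAdjoint_mul]

/-- `SL(n, ℍ)`: the `n × n` quaternionic matrices of quaternionic determinant one. -/
abbrev SLH (n : ℕ) : Submonoid (Matrix (Fin n) (Fin n) ℍ) := MonoidHom.mker (detHHom n)

theorem isUnit_of_detH_ne_zero {n : ℕ} (A : Matrix (Fin n) (Fin n) ℍ) (hA : detH A ≠ 0) :
    IsUnit A := by
  have inj : Function.Injective (LinearMap.mulLeft ℝ A) := by
    intro X Y h
    have h' : complexAdjoint A * complexAdjoint X = complexAdjoint A * complexAdjoint Y := by
      rw [← complexAdjoint_mul, ← complexAdjoint_mul]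
      exact congrArg complexAdjoint h
    have hu : IsUnit (complexAdjoint A) :=
      (Matrix.isUnit_iff_isUnit_det _).2 (isUnit_iff_ne_zero.2 hA)
    exact complexAdjoint_injective (hu.mul_left_cancel h')
  obtain ⟨X, hX⟩ := (LinearMap.injective_iff_surjective.1 inj) 1
  have hX : A * X = 1 := hX
  have hX' : X * A = 1 := inj (by
    change A * (X * A) = A * 1
    rw [← mul_assoc, hX, one_mul, mul_one])
  exact ⟨⟨A, X, hX, hX'⟩, rfl⟩

theorem isUnit_SLH {n : ℕ} (A : SLH n) : IsUnit A := by
  have hA : detHHom n A = 1 := A.2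
  obtain ⟨u, hu⟩ := isUnit_of_detH_ne_zero (A : Matrix (Fin n) (Fin n) ℍ)
    (by change detHHom n A ≠ 0; rw [hA]; exact one_ne_zero)
  have hB : detHHom n (↑u⁻¹ : Matrix (Fin n) (Fin n) ℍ) = 1 := by
    have h := congrArg (detHHom n) u.mul_inv
    rwa [map_mul, hu, hA, one_mul, map_one] at h
  refine ⟨⟨A, ⟨↑u⁻¹, hB⟩, Subtype.ext ?_, Subtype.ext ?_⟩, rfl⟩
  · change (A : Matrix (Fin n) (Fin n) ℍ) * (↑u⁻¹ : Matrix (Fin n) (Fin n) ℍ) = 1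
    rw [← hu, u.mul_inv]
  · change (↑u⁻¹ : Matrix (Fin n) (Fin n) ℍ) * (A : Matrix (Fin n) (Fin n) ℍ) = 1
    rw [← hu, u.inv_mul]

/-- `SL(n, ℍ)` is a group under matrix multiplication. -/
instance instGroupSLH (n : ℕ) : Group (SLH n) := groupOfIsUnit isUnit_SLH

theorem detH_real {n : ℕ} (B : Matrix (Fin n) (Fin n) ℝ) :
    detH (B.map (algebraMap ℝ ℍ)) = ((B.det : ℝ) : ℂ) ^ 2 := by
  have h : complexAdjoint (B.map (algebraMap ℝ ℍ)) =
      Matrix.fromBlocks (B.map Complex.ofRealHom) 0 0 (B.map Complex.ofRealHom) := by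
    ext i j
    rcases i with i | i <;> rcases j with j | j <;>
      simp [complexAdjoint, fstPart, sndPart, Complex.ext_iff]
  have hd : (B.map Complex.ofRealHom).det = ((B.det : ℝ) : ℂ) :=
    (RingHom.map_det Complex.ofRealHom B).symm
  rw [detH, h, Matrix.det_fromBlocks_zero₂₁, hd, sq]

/-- A real matrix of determinant one, viewed as an element of `SL(n, ℍ)`. -/
def ofReal {n : ℕ} (B : Matrix.SpecialLinearGroup (Fin n) ℝ) : SLH n :=
  ⟨(B : Matrix (Fin n) (Fin n) ℝ).map (algebraMap ℝ ℍ), by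
    rw [MonoidHom.mem_mker]
    change detH _ = 1
    rw [detH_real, B.2]; simp⟩

/-- An element of `SL(3, ℍ)` is simple if it is conjugate in `SL(3, ℍ)` to an element
of `SL(3, ℝ)`. -/
def IsSimple (g : SLH 3) : Prop :=
  ∃ B : Matrix.SpecialLinearGroup (Fin 3) ℝ, IsConj g (ofReal B)

/-- The quaternion `e ^ (i θ)`. -/
def expI (θ : ℝ) : ℍ := ((Complex.exp (θ * Complex.I) : ℂ) : ℍ)

end QuatSL

end

/-!
An element of `SL(3, ℍ)` that is not a real scalar, that is, not central, is conjugate to a matrix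
`L * diag(1, 1, d) * U` with `L` lower and `U` upper unipotent (`exists_isConj_pivots`,
`exists_triangular_factorization`). Moving the real matrix `diag(2, 1, 1/2)` into `L` and its
inverse into `U` gives triangular matrices with distinct real diagonal entries; they are
diagonalizable, hence simple. The determinant forces `‖d‖ = 1`.

The remaining factors come from imaginary units, that is, quaternions `p` with `p * p = -1`. All of
them are conjugate to each other, and `diag(p, q, 1)` is conjugate to a real rotation by a right
angle, for any two of them (`isRealConj_diag_imaginary`). Every unit quaternion is a product of two
imaginary units, so with `d = u * v` one has `diag(1, 1, d) = diag(i, 1, u) * diag(-i, 1, v)`, which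
makes four simple factors in all. For the scalar matrix `±1` a real diagonal matrix takes over the
role of the triangular factors.

For a diagonal matrix with unit entries each of the three entries is split into two imaginary
units, and the six units are distributed over three simple diagonal matrices. For a Jordan block
`e^{iθ}` of size two the first of the three factors becomes triangular, and the units can be chosen
such that this factor is still diagonalizable (`exists_three_factors_jordan`).

Simplicity asks for conjugacy inside `SL(3, ℍ)`, whereas the conjugators found above are merely
invertible. The same factorization shows that an invertible matrix has positive determinant
(`exists_detHHom_eq_pos`), so that a real multiple of the conjugator lies in `SL(3, ℍ)`
(`isConj_SLH_of_isConj`).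
-/

noncomputable section

namespace QuatSL

/-! ### Imaginary units -/

/-- The quaternion `i`. -/
def unitI : ℍ := ⟨0, 1, 0, 0⟩

/-- The quaternion `j`. -/
def unitJ : ℍ := ⟨0, 0, 1, 0⟩

@[simp] theorem re_unitI : unitI.re = 0 := rfl
@[simp] theorem imI_unitI : unitI.imI = 1 := rfl
@[simp] theorem imJ_unitI : unitI.imJ = 0 := rfl
@[simp] theorem imK_unitI : unitI.imK = 0 := rfl
@[simp] theorem re_unitJ : unitJ.re = 0 := rfl
@[simp] theorem imI_unitJ : unitJ.imI = 0 := rfl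
@[simp] theorem imJ_unitJ : unitJ.imJ = 1 := rfl
@[simp] theorem imK_unitJ : unitJ.imK = 0 := rfl

theorem unitI_mul_self : unitI * unitI = -1 := by
  ext <;> simp

theorem unitJ_mul_self : unitJ * unitJ = -1 := by
  ext <;> simp

/-- The second factor is any imaginary unit orthogonal to the imaginary part of `d`. -/
theorem exists_imaginary_mul (d : ℍ) (hd : Quaternion.normSq d = 1) :
    ∃ u v : ℍ, u * u = -1 ∧ v * v = -1 ∧ u * v = d := by
  obtain ⟨a, b, c, hn, ho⟩ : ∃ a b c : ℝ, a ^ 2 + b ^ 2 + c ^ 2 = 1 ∧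
      d.imI * a + d.imJ * b + d.imK * c = 0 := by
    by_cases h : d.imI ^ 2 + d.imJ ^ 2 = 0
    · exact ⟨1, 0, 0, by norm_num, by nlinarith⟩
    · have hs : √(d.imI ^ 2 + d.imJ ^ 2) ≠ 0 := by
        rw [Real.sqrt_ne_zero (by positivity)]; exact h
      refine ⟨-d.imJ / √(d.imI ^ 2 + d.imJ ^ 2), d.imI / √(d.imI ^ 2 + d.imJ ^ 2), 0, ?_, ?_⟩
      · field_simp
        rw [Real.sq_sqrt (by positivity)]; ring
      · field_simp; ring
  obtain ⟨v, v0, v1, v2, v3⟩ : ∃ v : ℍ, v.re = 0 ∧ v.imI = a ∧ v.imJ = b ∧ v.imK = c :=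
    ⟨⟨0, a, b, c⟩, rfl, rfl, rfl, rfl⟩
  have hv : v * v = -1 := by
    ext <;> simp [v0, v1, v2, v3] <;> nlinarith
  -- Orthogonality says that `v` intertwines `d` and its conjugate.
  have hvd : v * d = star d * v := by
    ext <;> simp [v0, v1, v2, v3] <;> linarith
  refine ⟨-(d * v), v, ?_, hv, ?_⟩
  · calc -(d * v) * -(d * v) = d * (v * d) * v := by noncomm_ring
      _ = (d * star d) * (v * v) := by rw [hvd]; noncomm_ring
      _ = -1 := by rw [hv, Quaternion.self_mul_star, hd]; simp
  · rw [neg_mul, mul_assoc, hv]; simp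

/-! ### Matrices conjugate to real ones -/

/-- A quaternionic matrix is `IsRealConj` if it is conjugate, by an invertible quaternionic matrix
that need not have determinant one, to a real matrix of determinant one. -/
def IsRealConj (S : Matrix (Fin 3) (Fin 3) ℍ) : Prop :=
  ∃ B : Matrix.SpecialLinearGroup (Fin 3) ℝ,
    IsConj S ((B : Matrix (Fin 3) (Fin 3) ℝ).map (algebraMap ℝ ℍ))

theorem IsRealConj.of_isConj {S T : Matrix (Fin 3) (Fin 3) ℍ} (hT : IsRealConj T)
    (h : IsConj S T) : IsRealConj S :=
  hT.imp fun _ hB => h.trans hB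

theorem isRealConj_of_real (S : Matrix (Fin 3) (Fin 3) ℍ) (B : Matrix (Fin 3) (Fin 3) ℝ)
    (hB : B.det = 1) (hS : S = B.map (algebraMap ℝ ℍ)) : IsRealConj S :=
  ⟨⟨B, hB⟩, by rw [hS]⟩

theorem isConj_of_mul_eq {S T : Matrix (Fin 3) (Fin 3) ℍ} (P Q : Matrix (Fin 3) (Fin 3) ℍ)
    (hPQ : P * Q = 1) (h : P * S = T * P) : IsConj S T :=
  ⟨⟨P, Q, hPQ, mul_eq_one_comm.1 hPQ⟩, h⟩

theorem isConj_mul_mul (S : Matrix (Fin 3) (Fin 3) ℍ) {P Q : Matrix (Fin 3) (Fin 3) ℍ}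
    (h : P * Q = 1) : IsConj S (Q * S * P) :=
  isConj_of_mul_eq Q P (mul_eq_one_comm.1 h) (by rw [mul_assoc, h, mul_one])

theorem isConj_submatrix (S : Matrix (Fin 3) (Fin 3) ℍ) (σ : Equiv.Perm (Fin 3)) :
    IsConj S (S.submatrix σ σ) := by
  refine isConj_of_mul_eq ((1 : Matrix (Fin 3) (Fin 3) ℍ).submatrix σ id)
    ((1 : Matrix (Fin 3) (Fin 3) ℍ).submatrix id σ) ?_ ?_
  · refine Matrix.ext fun i j => ?_
    simp [Matrix.mul_apply, Matrix.one_apply]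
  · refine Matrix.ext fun i j => ?_
    simp only [Matrix.mul_apply, Matrix.submatrix_apply, id, Matrix.one_apply]
    rw [Equiv.sum_comp σ (fun k => S (σ i) k * if k = j then 1 else 0)]
    simp

/-- The columns `(1, x)` and `(p, q * x)` span `ℍ²` as soon as `q * x ≠ x * p`, and in this basis
`diag(p, q)` is the real rotation by a right angle. -/
theorem isRealConj_diag_imaginary (p q : ℍ) (hp : p * p = -1) (hq : q * q = -1) :
    IsRealConj !![p, 0, 0; 0, q, 0; 0, 0, 1] := by
  obtain ⟨x, hx⟩ : ∃ x : ℍ, q * x - x * p ≠ 0 := by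
    by_contra! h
    have h1 : q = p := by simpa [sub_eq_zero] using h 1
    have hI := h unitI
    have hJ := h unitJ
    rw [h1] at hI hJ
    have e1 := congrArg QuaternionAlgebra.imK hI
    have e2 := congrArg QuaternionAlgebra.imJ hI
    have e3 := congrArg QuaternionAlgebra.imK hJ
    have e4 := congrArg QuaternionAlgebra.re hp
    simp at e1 e2 e3 e4
    have f1 : p.imJ = 0 := by linarith
    have f2 : p.imK = 0 := by linarith
    have f3 : p.imI = 0 := by linarith
    rw [f1, f2, f3] at e4
    nlinarith [sq_nonneg p.re]
  set δ := q * x - x * p with hδ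
  have hB : (!![0, -1, 0; 1, 0, 0; 0, 0, 1] : Matrix (Fin 3) (Fin 3) ℝ).det = 1 := by
    simp [Matrix.det_fin_three]
  refine ⟨⟨_, hB⟩, (isConj_of_mul_eq !![1, p, 0; x, q * x, 0; 0, 0, 1]
    !![1 + p * δ⁻¹ * x, -(p * δ⁻¹), 0; -(δ⁻¹ * x), δ⁻¹, 0; 0, 0, 1] ?_ ?_).symm⟩
  · have h2 : q * x * δ⁻¹ - x * p * δ⁻¹ = 1 := by rw [← sub_mul, ← hδ, mul_inv_cancel₀ hx]
    have h3 : q * x * δ⁻¹ = 1 + x * p * δ⁻¹ := by rw [← h2]; abel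
    refine Matrix.ext fun i j => ?_
    fin_cases i <;> fin_cases j <;>
      simp [Matrix.mul_apply, Fin.sum_univ_three, mul_add, ← mul_assoc, h3, add_mul]
  · refine Matrix.ext fun i j => ?_
    fin_cases i <;> fin_cases j <;>
      simp [Matrix.mul_apply, Fin.sum_univ_three, ← mul_assoc, hp, hq]

theorem isRealConj_diag_imaginary_fst_thd (p q : ℍ) (hp : p * p = -1) (hq : q * q = -1) :
    IsRealConj !![p, 0, 0; 0, 1, 0; 0, 0, q] := by
  refine (isRealConj_diag_imaginary p q hp hq).of_isConj ?_
  convert isConj_submatrix _ (Equiv.swap 1 2) using 1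
  refine Matrix.ext fun i j => ?_
  fin_cases i <;> fin_cases j <;> simp [Equiv.swap_apply_def]

theorem isRealConj_diag_imaginary_snd_thd (p q : ℍ) (hp : p * p = -1) (hq : q * q = -1) :
    IsRealConj !![1, 0, 0; 0, p, 0; 0, 0, q] := by
  refine (isRealConj_diag_imaginary q p hq hp).of_isConj ?_
  convert isConj_submatrix _ (Equiv.swap 0 2) using 1
  refine Matrix.ext fun i j => ?_
  fin_cases i <;> fin_cases j <;> simp [Equiv.swap_apply_def]

/-- The diagonal entries are distinct and central, so the matrix is diagonalizable; the columns of
the unipotent conjugator are its eigenvectors. -/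
theorem isRealConj_lowerTriangular (x y z : ℍ) :
    IsRealConj !![((2 : ℝ) : ℍ), 0, 0; x, 1, 0; z, y, ((2⁻¹ : ℝ) : ℍ)] := by
  refine IsRealConj.of_isConj (T := !![((2 : ℝ) : ℍ), 0, 0; 0, 1, 0; 0, 0, ((2⁻¹ : ℝ) : ℍ)])
    (isRealConj_of_real _ !![2, 0, 0; 0, 1, 0; 0, 0, (2 : ℝ)⁻¹] (by simp [Matrix.det_fin_three])
      ?_) (isConj_of_mul_eq
        !![1, 0, 0; x, 1, 0; (2 / 3 : ℝ) • (z + y * x), (2 : ℝ) • y, 1]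
        !![1, 0, 0; -x, 1, 0; (2 : ℝ) • (y * x) - (2 / 3 : ℝ) • (z + y * x), -((2 : ℝ) • y), 1]
        ?_ ?_).symm
  · refine Matrix.ext fun i j => ?_
    fin_cases i <;> fin_cases j <;> simp
  · refine Matrix.ext fun i j => ?_
    fin_cases i <;> fin_cases j <;> simp [Matrix.mul_apply, Fin.sum_univ_three]
    abel
  · refine Matrix.ext fun i j => ?_
    fin_cases i <;> fin_cases j <;>
      simp [Matrix.mul_apply, Fin.sum_univ_three, -Quaternion.coe_inv] <;>
      ext <;> simp [-Quaternion.coe_inv] <;> ring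

theorem isRealConj_upperTriangular (x y z : ℍ) :
    IsRealConj !![((2⁻¹ : ℝ) : ℍ), y, z; 0, 1, x; 0, 0, ((2 : ℝ) : ℍ)] := by
  refine (isRealConj_lowerTriangular x y z).of_isConj ?_
  convert isConj_submatrix _ (Equiv.swap 0 2) using 1
  refine Matrix.ext fun i j => ?_
  fin_cases i <;> fin_cases j <;> simp [Equiv.swap_apply_def]

theorem diag_eq_mul_of_imaginary {u v d : ℍ} (h : u * v = d) :
    !![1, 0, 0; 0, 1, 0; 0, 0, d] =
      !![unitI, 0, 0; 0, 1, 0; 0, 0, u] * !![-unitI, 0, 0; 0, 1, 0; 0, 0, v] := by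
  refine Matrix.ext fun i j => ?_
  fin_cases i <;> fin_cases j <;>
    simp [Matrix.mul_apply, Fin.sum_univ_three, unitI_mul_self, h]

/-! ### The quaternionic determinant under conjugation and on diagonal matrices -/

theorem detHHom_eq_of_isConj {S T : Matrix (Fin 3) (Fin 3) ℍ} (h : IsConj S T) :
    detHHom 3 S = detHHom 3 T := by
  obtain ⟨c, hc⟩ := h
  have h1 := congrArg (detHHom 3) hc.eq
  rw [map_mul, map_mul, mul_comm] at h1
  exact (c.isUnit.map (detHHom 3)).mul_right_cancel h1

theorem IsRealConj.detHHom_eq_one {S : Matrix (Fin 3) (Fin 3) ℍ} (h : IsRealConj S) :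
    detHHom 3 S = 1 := by
  obtain ⟨B, hB⟩ := h
  rw [detHHom_eq_of_isConj hB]
  exact (ofReal B).2

theorem detHHom_real (B : Matrix (Fin 3) (Fin 3) ℝ) :
    detHHom 3 (B.map (algebraMap ℝ ℍ)) = ((B.det : ℝ) : ℂ) ^ 2 :=
  detH_real B

/-- For `‖d‖ = 1` the matrix is a product of two real conjugates, which have determinant one; the
rest is a real matrix. -/
theorem detHHom_diag (d : ℍ) :
    detHHom 3 !![1, 0, 0; 0, 1, 0; 0, 0, d] = ((Quaternion.normSq d : ℝ) : ℂ) := by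
  have hr : ∀ r : ℝ, detHHom 3 !![1, 0, 0; 0, 1, 0; 0, 0, (r : ℍ)] = ((r : ℝ) : ℂ) ^ 2 := by
    intro r
    have h := detHHom_real !![1, 0, 0; 0, 1, 0; 0, 0, r]
    rw [show (!![1, 0, 0; 0, 1, 0; 0, 0, r] : Matrix (Fin 3) (Fin 3) ℝ).det = r by
      simp [Matrix.det_fin_three]] at h
    rw [← h]
    congr 1
    refine Matrix.ext fun i j => ?_
    fin_cases i <;> fin_cases j <;> simp
  by_cases h0 : d = 0
  · have := hr 0
    simpa [h0] using this
  · have hn : ‖d‖ ≠ 0 := norm_ne_zero_iff.2 h0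
    have he : Quaternion.normSq ((‖d‖⁻¹ : ℝ) • d) = 1 := by
      rw [Quaternion.normSq_smul, Quaternion.normSq_eq_norm_mul_self]
      field_simp
    obtain ⟨u, v, hu, hv, huv⟩ := exists_imaginary_mul _ he
    have hd : !![1, 0, 0; 0, 1, 0; 0, 0, d] = !![1, 0, 0; 0, 1, 0; 0, 0, (‖d‖⁻¹ : ℝ) • d] *
        !![1, 0, 0; 0, 1, 0; 0, 0, ((‖d‖ : ℝ) : ℍ)] := by
      refine Matrix.ext fun i j => ?_
      fin_cases i <;> fin_cases j <;> simp [Matrix.mul_apply, Fin.sum_univ_three]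
      rw [← Quaternion.coe_commutes, Quaternion.coe_mul_eq_smul, smul_smul, inv_mul_cancel₀ hn,
        one_smul]
    rw [hd, map_mul, hr, diag_eq_mul_of_imaginary huv, map_mul,
      (isRealConj_diag_imaginary_fst_thd _ _ unitI_mul_self hu).detHHom_eq_one,
      (isRealConj_diag_imaginary_fst_thd _ _ (by rw [neg_mul_neg, unitI_mul_self]) hv).detHHom_eq_one,
      Quaternion.normSq_eq_norm_mul_self]
    push_cast
    ring

/-! ### Triangular factorization up to conjugacy -/

/-- If the first two leading pivots of `M` are `1` then `M = L * diag(1, 1, d) * U` with `L` and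
`U` unipotent; the real diagonal matrix `diag(2, 1, 1/2)` commutes with the middle factor, and
moving it into `L` and its inverse into `U` makes both triangular factors diagonalizable. -/
theorem exists_triangular_factorization (M : Matrix (Fin 3) (Fin 3) ℍ) (h0 : M 0 0 = 1)
    (h1 : M 1 1 = 1 + M 1 0 * M 0 1) :
    ∃ X Y d, IsRealConj X ∧ IsRealConj Y ∧ M = X * !![1, 0, 0; 0, 1, 0; 0, 0, d] * Y := by
  refine ⟨_, _, M 2 2 - M 2 0 * M 0 2 - (M 2 1 - M 2 0 * M 0 1) * (M 1 2 - M 1 0 * M 0 2),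
    isRealConj_lowerTriangular ((2 : ℝ) • M 1 0) (M 2 1 - M 2 0 * M 0 1) ((2 : ℝ) • M 2 0),
    isRealConj_upperTriangular (M 1 2 - M 1 0 * M 0 2) ((2⁻¹ : ℝ) • M 0 1) ((2⁻¹ : ℝ) • M 0 2), ?_⟩
  refine Matrix.ext fun i j => ?_
  fin_cases i <;> fin_cases j <;>
    simp [Matrix.mul_apply, Fin.sum_univ_three, h0, h1, Quaternion.coe_mul_eq_smul,
      Quaternion.mul_coe_eq_smul, smul_smul, -Quaternion.coe_inv]
  · ext <;> simp [-Quaternion.coe_inv]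
  · exact add_comm _ _

theorem exists_real_of_commute (x : ℍ) (h : ∀ t, t * x = x * t) : ∃ r : ℝ, x = r := by
  have e1 := congrArg QuaternionAlgebra.imK (h unitI)
  have e2 := congrArg QuaternionAlgebra.imJ (h unitI)
  have e3 := congrArg QuaternionAlgebra.imK (h unitJ)
  simp at e1 e2 e3
  refine ⟨x.re, ?_⟩
  ext <;> simp <;> linarith

/-- A matrix that is not a real scalar has a conjugate with a nonzero entry below the corner. -/
theorem exists_isConj_entry_ne_zero (A : Matrix (Fin 3) (Fin 3) ℍ)
    (h : ∀ r : ℝ, A ≠ !![(r : ℍ), 0, 0; 0, (r : ℍ), 0; 0, 0, (r : ℍ)]) :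
    ∃ M, IsConj A M ∧ M 1 0 ≠ 0 := by
  by_cases hoff : ∃ i j, i ≠ j ∧ A i j ≠ 0
  · obtain ⟨i, j, hij, hA⟩ := hoff
    obtain ⟨σ, h0, h1⟩ : ∃ σ : Equiv.Perm (Fin 3), σ 0 = j ∧ σ 1 = i := by
      clear hA; revert i j; decide
    exact ⟨_, isConj_submatrix A σ, by simpa [h0, h1] using hA⟩
  push Not at hoff
  -- Conjugating a diagonal matrix by a transvection with entry `t` creates the entry
  -- `t * A i i - A j j * t`, so all these vanish only for equal central diagonal entries.
  by_contra! hM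
  have key : ∀ (σ : Equiv.Perm (Fin 3)) (t : ℍ),
      t * A (σ 0) (σ 0) = A (σ 1) (σ 1) * t := by
    intro σ t
    have hPQ : (!![1, 0, 0; -t, 1, 0; 0, 0, 1] : Matrix (Fin 3) (Fin 3) ℍ) *
        !![1, 0, 0; t, 1, 0; 0, 0, 1] = 1 := by
      refine Matrix.ext fun i j => ?_
      fin_cases i <;> fin_cases j <;> simp [Matrix.mul_apply, Fin.sum_univ_three]
    have h1 := hM _ ((isConj_submatrix A σ).trans (isConj_mul_mul _ hPQ))
    have h10 : A (σ 1) (σ 0) = 0 := hoff _ _ (by simp)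
    have h01 : A (σ 0) (σ 1) = 0 := hoff _ _ (by simp)
    simpa [-Matrix.cons_mul, Matrix.mul_apply, Fin.sum_univ_three, h10, h01, ← sub_eq_add_neg, sub_eq_zero]
      using h1
  have h1 : A 0 0 = A 1 1 := by simpa using key 1 1
  have h2 : A 0 0 = A 2 2 := by simpa [Equiv.swap_apply_def] using key (Equiv.swap 1 2) 1
  obtain ⟨r, hr⟩ := exists_real_of_commute (A 0 0) fun t => by simpa [← h1] using key 1 t
  refine h r (Matrix.ext fun i j => ?_)
  fin_cases i <;> fin_cases j <;> simp [hoff, hr, ← h1, ← h2]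

/-- The new basis is `e₁`, `A e₁ - e₁`, `e₃`. -/
theorem exists_isConj_firstColumn (A : Matrix (Fin 3) (Fin 3) ℍ) (h : A 1 0 ≠ 0) :
    ∃ M, IsConj A M ∧ M 0 0 = 1 ∧ M 1 0 = 1 ∧ M 2 0 = 0 := by
  have hPQ : !![1, A 0 0 - 1, 0; 0, A 1 0, 0; 0, A 2 0, 1] *
      !![1, -((A 0 0 - 1) * (A 1 0)⁻¹), 0; 0, (A 1 0)⁻¹, 0; 0, -(A 2 0 * (A 1 0)⁻¹), 1] = 1 := by
    refine Matrix.ext fun i j => ?_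
    fin_cases i <;> fin_cases j <;> simp [-Matrix.cons_mul, Matrix.mul_apply, Fin.sum_univ_three, h]
  refine ⟨_, isConj_mul_mul A hPQ, ?_, ?_, ?_⟩ <;>
    simp [-Matrix.cons_mul, Matrix.mul_apply, Fin.sum_univ_three, h, mul_assoc]

/-- If `M 2 1 ≠ 0` the new basis is `e₁`, `e₂`, `M e₂ - e₂`. Otherwise it is `e₁`, `e₃`,
`e₂ + e₃ y`, and the pivot condition is the linear equation `y * (M 1 2 - M 0 2) = M 2 2 - 1`. -/
theorem exists_isConj_pivots_of_ne (M : Matrix (Fin 3) (Fin 3) ℍ)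
    (h0 : M 0 0 = 1) (h1 : M 1 0 = 1) (h2 : M 2 0 = 0) (h : M 2 1 ≠ 0 ∨ M 1 2 - M 0 2 ≠ 0) :
    ∃ N, IsConj M N ∧ N 0 0 = 1 ∧ N 1 1 = 1 + N 1 0 * N 0 1 := by
  by_cases hm : M 2 1 = 0
  · have h : M 1 2 - M 0 2 ≠ 0 := h.resolve_left (not_not.2 hm)
    obtain ⟨y, hy⟩ : ∃ y, y * (M 1 2 - M 0 2) = M 2 2 - 1 :=
      ⟨(M 2 2 - 1) * (M 1 2 - M 0 2)⁻¹, by rw [mul_assoc, inv_mul_cancel₀ h, mul_one]⟩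
    have hPQ : (!![1, 0, 0; 0, 0, 1; 0, 1, y] : Matrix (Fin 3) (Fin 3) ℍ) *
        !![1, 0, 0; 0, -y, 1; 0, 1, 0] = 1 := by
      refine Matrix.ext fun i j => ?_
      fin_cases i <;> fin_cases j <;> simp [Matrix.mul_apply, Fin.sum_univ_three]
    refine ⟨_, isConj_mul_mul M hPQ, ?_, ?_⟩
    · simp [-Matrix.cons_mul, Matrix.mul_apply, Fin.sum_univ_three, h0]
    · simp [-Matrix.cons_mul, Matrix.mul_apply, Fin.sum_univ_three, h0, h1, h2]
      rw [mul_sub, sub_eq_iff_eq_add] at hy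
      rw [hy]; abel
  · have hPQ : !![1, 0, M 0 1; 0, 1, M 1 1 - 1; 0, 0, M 2 1] *
        !![1, 0, -(M 0 1 * (M 2 1)⁻¹); 0, 1, -((M 1 1 - 1) * (M 2 1)⁻¹); 0, 0, (M 2 1)⁻¹] = 1 := by
      refine Matrix.ext fun i j => ?_
      fin_cases i <;> fin_cases j <;> simp [-Matrix.cons_mul, Matrix.mul_apply, Fin.sum_univ_three, hm]
    refine ⟨_, isConj_mul_mul M hPQ, ?_, ?_⟩ <;>
      simp [-Matrix.cons_mul, Matrix.mul_apply, Fin.sum_univ_three, h0, h1, h2, hm, mul_assoc]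

theorem exists_isConj_pivots (M : Matrix (Fin 3) (Fin 3) ℍ) (hu : IsUnit M)
    (h0 : M 0 0 = 1) (h1 : M 1 0 = 1) (h2 : M 2 0 = 0) :
    ∃ N, IsConj M N ∧ N 0 0 = 1 ∧ N 1 1 = 1 + N 1 0 * N 0 1 := by
  by_cases h : M 2 1 ≠ 0 ∨ M 1 2 - M 0 2 ≠ 0
  · exact exists_isConj_pivots_of_ne M h0 h1 h2 h
  push Not at h
  obtain ⟨hm, hz⟩ := h
  have hμ : M 2 2 ≠ 0 := by
    intro hμ
    obtain ⟨X, hX⟩ := hu.exists_right_inv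
    have := congrFun₂ hX 2 2
    simp [-Matrix.cons_mul, Matrix.mul_apply, Fin.sum_univ_three, h2, hm, hμ] at this
  -- Replacing `e₃` by `e₃ + e₁` adds `M 2 2` to `M 1 2 - M 0 2`.
  have hPQ : (!![1, 0, 1; 0, 1, 0; 0, 0, 1] : Matrix (Fin 3) (Fin 3) ℍ) *
      !![1, 0, -1; 0, 1, 0; 0, 0, 1] = 1 := by
    refine Matrix.ext fun i j => ?_
    fin_cases i <;> fin_cases j <;> simp [Matrix.mul_apply, Fin.sum_univ_three]
  have hc := isConj_mul_mul M hPQ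
  obtain ⟨N, hN, hN'⟩ := exists_isConj_pivots_of_ne
    (!![1, 0, -1; 0, 1, 0; 0, 0, 1] * M * !![1, 0, 1; 0, 1, 0; 0, 0, 1])
    (by simp [-Matrix.cons_mul, Matrix.mul_apply, Fin.sum_univ_three, h0, h2])
    (by simp [-Matrix.cons_mul, Matrix.mul_apply, Fin.sum_univ_three, h1])
    (by simp [-Matrix.cons_mul, Matrix.mul_apply, Fin.sum_univ_three, h2])
    (Or.inr (by
      simp [-Matrix.cons_mul, Matrix.mul_apply, Fin.sum_univ_three, h0, h1, h2, sub_eq_zero.1 hz]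
      exact hμ))
  exact ⟨N, hc.trans hN, hN'⟩

theorem exists_isConj_factorization (A : Matrix (Fin 3) (Fin 3) ℍ) (hu : IsUnit A)
    (h : ∀ r : ℝ, A ≠ !![(r : ℍ), 0, 0; 0, (r : ℍ), 0; 0, 0, (r : ℍ)]) :
    ∃ X Y d, IsRealConj X ∧ IsRealConj Y ∧
      IsConj A (X * !![1, 0, 0; 0, 1, 0; 0, 0, d] * Y) := by
  obtain ⟨M, hM, hne⟩ := exists_isConj_entry_ne_zero A h
  obtain ⟨M', hM', h0, h1, h2⟩ := exists_isConj_firstColumn M hne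
  have hu' : IsUnit M' := by
    obtain ⟨c, hc⟩ := hM.trans hM'
    have h3 : M' = c * A * (c⁻¹ : (Matrix (Fin 3) (Fin 3) ℍ)ˣ) := by
      rw [hc.eq, mul_assoc, Units.mul_inv, mul_one]
    rw [h3]
    exact (c.isUnit.mul hu).mul c⁻¹.isUnit
  obtain ⟨N, hN, h3, h4⟩ := exists_isConj_pivots M' hu' h0 h1 h2
  obtain ⟨X, Y, d, hX, hY, hXY⟩ := exists_triangular_factorization N h3 h4
  exact ⟨X, Y, d, hX, hY, hXY ▸ (hM.trans hM').trans hN⟩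

/-! ### Positivity of the determinant and rescaling of conjugators -/

theorem detHHom_scalar (r : ℝ) :
    detHHom 3 !![(r : ℍ), 0, 0; 0, (r : ℍ), 0; 0, 0, (r : ℍ)] = ((r ^ 6 : ℝ) : ℂ) := by
  have h := detHHom_real !![r, 0, 0; 0, r, 0; 0, 0, r]
  have h1 : (!![r, 0, 0; 0, r, 0; 0, 0, r] : Matrix (Fin 3) (Fin 3) ℝ).det = r ^ 3 := by
    simp [Matrix.det_fin_three]; ring
  have h2 : (!![r, 0, 0; 0, r, 0; 0, 0, r] : Matrix (Fin 3) (Fin 3) ℝ).map (algebraMap ℝ ℍ) =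
      !![(r : ℍ), 0, 0; 0, (r : ℍ), 0; 0, 0, (r : ℍ)] := by
    refine Matrix.ext fun i j => ?_
    fin_cases i <;> fin_cases j <;> simp
  rw [h1, h2] at h
  rw [h]; push_cast; ring

/-- Only the entry `d` of the triangular factorization contributes, with `‖d‖ ^ 2`. -/
theorem exists_detHHom_eq_pos (A : Matrix (Fin 3) (Fin 3) ℍ) (hu : IsUnit A) :
    ∃ r : ℝ, 0 < r ∧ detHHom 3 A = (r : ℂ) := by
  suffices h : ∃ r : ℝ, 0 ≤ r ∧ detHHom 3 A = (r : ℂ) by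
    obtain ⟨r, hr, hA⟩ := h
    refine ⟨r, hr.lt_of_ne ?_, hA⟩
    rintro rfl
    exact (hu.map (detHHom 3)).ne_zero (by simpa using hA)
  by_cases h : ∀ r : ℝ, A ≠ !![(r : ℍ), 0, 0; 0, (r : ℍ), 0; 0, 0, (r : ℍ)]
  · obtain ⟨X, Y, d, hX, hY, hA⟩ := exists_isConj_factorization A hu h
    refine ⟨Quaternion.normSq d, Quaternion.normSq_nonneg, ?_⟩
    rw [detHHom_eq_of_isConj hA, map_mul, map_mul, hX.detHHom_eq_one, hY.detHHom_eq_one,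
      detHHom_diag, one_mul, mul_one]
  · push Not at h
    obtain ⟨r, rfl⟩ := h
    exact ⟨r ^ 6, by positivity, detHHom_scalar r⟩

/-- An invertible conjugator has positive determinant, so a positive real multiple of it, which
conjugates in the same way, lies in `SL(3, ℍ)`. -/
theorem isConj_SLH_of_isConj {S T : SLH 3}
    (h : IsConj (S : Matrix (Fin 3) (Fin 3) ℍ) (T : Matrix (Fin 3) (Fin 3) ℍ)) : IsConj S T := by
  obtain ⟨c, hc⟩ := h
  obtain ⟨r, hr, hcr⟩ := exists_detHHom_eq_pos _ c.isUnit
  obtain ⟨t, ht0, ht⟩ : ∃ t : ℝ, 0 < t ∧ t ^ 6 = r⁻¹ :=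
    ⟨r⁻¹ ^ ((6 : ℝ)⁻¹), by positivity, by
      rw [← Real.rpow_natCast, ← Real.rpow_mul (by positivity)]; norm_num⟩
  set D : Matrix (Fin 3) (Fin 3) ℍ := !![(t : ℍ), 0, 0; 0, (t : ℍ), 0; 0, 0, (t : ℍ)] with hD
  have hcomm : ∀ X, D * X = X * D := by
    intro X
    refine Matrix.ext fun i j => ?_
    fin_cases i <;> fin_cases j <;>
      simp [hD, Matrix.mul_apply, Fin.sum_univ_three, Quaternion.coe_commutes]
  have hmem : D * (c : Matrix (Fin 3) (Fin 3) ℍ) ∈ SLH 3 := by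
    rw [MonoidHom.mem_mker, map_mul, hcr, hD, detHHom_scalar, ht, ← Complex.ofReal_mul,
      inv_mul_cancel₀ hr.ne', Complex.ofReal_one]
  obtain ⟨u, hu⟩ := isUnit_SLH (⟨_, hmem⟩ : SLH 3)
  refine ⟨u, ?_⟩
  rw [hu]
  refine Subtype.ext ?_
  change D * c * S = T * (D * c)
  rw [mul_assoc, hc.eq, ← mul_assoc, hcomm, mul_assoc]

theorem IsRealConj.exists_isSimple {S : Matrix (Fin 3) (Fin 3) ℍ} (h : IsRealConj S) :
    ∃ s : SLH 3, IsSimple s ∧ (s : Matrix (Fin 3) (Fin 3) ℍ) = S := by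
  obtain ⟨B, hB⟩ := id h
  exact ⟨⟨S, h.detHHom_eq_one⟩, ⟨B, isConj_SLH_of_isConj hB⟩, rfl⟩

/-- The conjugator of the product conjugates every factor, which turns each into a simple element
of `SL(3, ℍ)`. -/
theorem exists_list_isSimple (A : SLH 3) (l : List (Matrix (Fin 3) (Fin 3) ℍ))
    (hl : ∀ S ∈ l, IsRealConj S) (h : IsConj (A : Matrix (Fin 3) (Fin 3) ℍ) l.prod) :
    ∃ l' : List (SLH 3), l'.length = l.length ∧ (∀ s ∈ l', IsSimple s) ∧ A = l'.prod := by
  have key : ∀ l : List (Matrix (Fin 3) (Fin 3) ℍ), (∀ S ∈ l, IsRealConj S) →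
      ∃ l' : List (SLH 3), l'.length = l.length ∧ (∀ s ∈ l', IsSimple s) ∧
        (l'.prod : Matrix (Fin 3) (Fin 3) ℍ) = l.prod := by
    intro l
    induction l with
    | nil => exact fun _ => ⟨[], rfl, by simp, rfl⟩
    | cons S l ih =>
      intro h
      obtain ⟨l', h1, h2, h3⟩ := ih fun T hT => h T (List.mem_cons_of_mem _ hT)
      obtain ⟨s, hs, rfl⟩ := (h S List.mem_cons_self).exists_isSimple
      refine ⟨s :: l', by simp [h1], List.forall_mem_cons.2 ⟨hs, h2⟩, ?_⟩
      rw [List.prod_cons, List.prod_cons, ← h3]; rfl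
  obtain ⟨l', h1, h2, h3⟩ := key l hl
  rw [← h3] at h
  obtain ⟨c, hc⟩ := isConj_iff.1 (isConj_SLH_of_isConj h).symm
  refine ⟨l'.map (MulAut.conj c), by simp [h1], ?_, ?_⟩
  · intro s hs
    obtain ⟨s, hs', rfl⟩ := List.mem_map.1 hs
    obtain ⟨B, hB⟩ := h2 s hs'
    exact ⟨B, (isConj_iff.2 ⟨c, rfl⟩ : IsConj s (MulAut.conj c s)).symm.trans hB⟩
  · rw [← hc, ← map_list_prod]; rfl

/-! ### Four factors in general -/

/-- The middle factor `diag(1, 1, d)` of the triangular factorization has `‖d‖ = 1`, hence is itself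
a product of two real conjugates. Central elements are `±1` and are treated apart. -/
theorem exists_four_factors (A : SLH 3) :
    ∃ S₁ S₂ S₃ S₄, IsRealConj S₁ ∧ IsRealConj S₂ ∧ IsRealConj S₃ ∧ IsRealConj S₄ ∧
      IsConj (A : Matrix (Fin 3) (Fin 3) ℍ) (S₁ * S₂ * S₃ * S₄) := by
  have hA : detHHom 3 (A : Matrix (Fin 3) (Fin 3) ℍ) = 1 := A.2
  have hu : IsUnit (A : Matrix (Fin 3) (Fin 3) ℍ) := (isUnit_SLH A).map (SLH 3).subtype
  obtain ⟨X, Y, d, hX, hY, hXY⟩ : ∃ X Y d, IsRealConj X ∧ IsRealConj Y ∧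
      IsConj (A : Matrix (Fin 3) (Fin 3) ℍ) (X * !![1, 0, 0; 0, 1, 0; 0, 0, d] * Y) := by
    by_cases h : ∀ r : ℝ, (A : Matrix (Fin 3) (Fin 3) ℍ) ≠
        !![(r : ℍ), 0, 0; 0, (r : ℍ), 0; 0, 0, (r : ℍ)]
    · exact exists_isConj_factorization _ hu h
    · push Not at h
      obtain ⟨r, hr⟩ := h
      rw [hr, detHHom_scalar] at hA
      have hr2 : r * r = 1 := by
        have h6 : (r ^ 2) ^ 3 = 1 := by rw [← pow_mul]; exact_mod_cast hA
        rw [← sq]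
        exact (pow_eq_one_iff_of_nonneg (sq_nonneg r) (by norm_num)).1 h6
      refine ⟨!![(r : ℍ), 0, 0; 0, (r : ℍ), 0; 0, 0, 1], 1, r,
        isRealConj_of_real _ !![r, 0, 0; 0, r, 0; 0, 0, 1] ?_ ?_,
        isRealConj_of_real _ 1 Matrix.det_one ?_, ?_⟩
      · simp [Matrix.det_fin_three, hr2]
      · refine Matrix.ext fun i j => ?_
        fin_cases i <;> fin_cases j <;> simp
      · exact (Matrix.map_one _ (map_zero _) (map_one _)).symm
      · rw [hr]
        convert IsConj.refl _ using 1
        refine Matrix.ext fun i j => ?_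
        fin_cases i <;> fin_cases j <;> simp [Matrix.mul_apply, Fin.sum_univ_three]
  have hd : Quaternion.normSq d = 1 := by
    rw [detHHom_eq_of_isConj hXY, map_mul, map_mul, hX.detHHom_eq_one, hY.detHHom_eq_one,
      detHHom_diag, one_mul, mul_one] at hA
    exact_mod_cast hA
  obtain ⟨u, v, hu, hv, huv⟩ := exists_imaginary_mul d hd
  refine ⟨X, _, _, Y, hX, isRealConj_diag_imaginary_fst_thd _ _ unitI_mul_self hu,
    isRealConj_diag_imaginary_fst_thd _ _ (by rw [neg_mul_neg, unitI_mul_self]) hv, hY, ?_⟩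
  rwa [diag_eq_mul_of_imaginary huv, ← mul_assoc X] at hXY

/-! ### Three factors for unit complex eigenvalues -/

@[simp] theorem re_expI (θ : ℝ) : (expI θ).re = Real.cos θ := by
  simp [expI, Complex.exp_ofReal_mul_I_re]

@[simp] theorem imI_expI (θ : ℝ) : (expI θ).imI = Real.sin θ := by
  simp [expI, Complex.exp_ofReal_mul_I_im]

@[simp] theorem imJ_expI (θ : ℝ) : (expI θ).imJ = 0 := by simp [expI]

@[simp] theorem imK_expI (θ : ℝ) : (expI θ).imK = 0 := by simp [expI]

theorem unitJ_mul_expI (θ : ℝ) : unitJ * expI θ = expI (-θ) * unitJ := by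
  ext <;> simp

theorem expI_add (θ φ : ℝ) : expI (θ + φ) = expI θ * expI φ := by
  ext <;> simp [Real.cos_add, Real.sin_add]; ring

theorem expI_zero : expI 0 = 1 := by simp [expI]

theorem expI_mul_unitJ_mul_expI_mul_unitJ (θ φ : ℝ) :
    expI θ * unitJ * (expI φ * unitJ) = -expI (θ - φ) := by
  rw [mul_assoc, ← mul_assoc unitJ, unitJ_mul_expI, mul_assoc, unitJ_mul_self, ← mul_assoc,
    ← expI_add, ← sub_eq_add_neg]
  simp

theorem expI_mul_unitJ_mul_self (θ : ℝ) : expI θ * unitJ * (expI θ * unitJ) = -1 := by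
  rw [expI_mul_unitJ_mul_expI_mul_unitJ, sub_self, expI_zero]

theorem neg_unitJ_mul_self : -unitJ * -unitJ = -1 := by
  rw [neg_mul_neg, unitJ_mul_self]

/-- Each diagonal entry is a product of two imaginary units, and these six units are distributed
over three matrices that each have `1` as their remaining diagonal entry. -/
theorem exists_three_factors_diag (θ φ ψ : ℝ) :
    ∃ S₁ S₂ S₃, IsRealConj S₁ ∧ IsRealConj S₂ ∧ IsRealConj S₃ ∧
      !![expI θ, 0, 0; 0, expI φ, 0; 0, 0, expI ψ] = S₁ * S₂ * S₃ := by
  refine ⟨_, _, _, isRealConj_diag_imaginary (expI θ * unitJ) (expI φ * unitJ)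
      (expI_mul_unitJ_mul_self θ) (expI_mul_unitJ_mul_self φ),
    isRealConj_diag_imaginary_snd_thd (-unitJ) (expI ψ * unitJ) neg_unitJ_mul_self
      (expI_mul_unitJ_mul_self ψ),
    isRealConj_diag_imaginary_fst_thd (-unitJ) (-unitJ) neg_unitJ_mul_self neg_unitJ_mul_self, ?_⟩
  refine Matrix.ext fun i j => ?_
  fin_cases i <;> fin_cases j <;>
    simp [Matrix.mul_apply, Fin.sum_univ_three, mul_assoc, unitJ_mul_self]

/-- The diagonal imaginary units are chosen such that the upper left block of the first factor is
still diagonalizable: with `u = -e^{-iθ} j` and `v = e^{iθ} j` the equation `u * x - x * v = -j`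
has the solution `x = e^{-iθ} / 2`. -/
theorem exists_three_factors_jordan (θ ψ : ℝ) :
    ∃ S₁ S₂ S₃, IsRealConj S₁ ∧ IsRealConj S₂ ∧ IsRealConj S₃ ∧
      !![expI θ, 1, 0; 0, expI θ, 0; 0, 0, expI ψ] = S₁ * S₂ * S₃ := by
  refine ⟨!![-(expI (-θ) * unitJ), unitJ, 0; 0, expI θ * unitJ, 0; 0, 0, 1], _, _,
    (isRealConj_diag_imaginary (-(expI (-θ) * unitJ)) (expI θ * unitJ) ?_
      (expI_mul_unitJ_mul_self θ)).of_isConj (isConj_of_mul_eq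
        !![1, (2⁻¹ : ℝ) • expI (-θ), 0; 0, 1, 0; 0, 0, 1]
        !![1, -((2⁻¹ : ℝ) • expI (-θ)), 0; 0, 1, 0; 0, 0, 1] ?_ ?_).symm,
    isRealConj_diag_imaginary_snd_thd (-unitJ) (expI ψ * unitJ) neg_unitJ_mul_self
      (expI_mul_unitJ_mul_self ψ),
    isRealConj_diag_imaginary_fst_thd (expI (-(2 * θ)) * unitJ) (-unitJ) (expI_mul_unitJ_mul_self _)
      neg_unitJ_mul_self, ?_⟩
  · rw [neg_mul_neg, expI_mul_unitJ_mul_self]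
  · refine Matrix.ext fun i j => ?_
    fin_cases i <;> fin_cases j <;> simp [Matrix.mul_apply, Fin.sum_univ_three]
  · have h1 : expI (-θ) * (expI θ * unitJ) = unitJ := by
      rw [← mul_assoc, ← expI_add, neg_add_cancel, expI_zero, one_mul]
    have h2 : expI (-θ) * (unitJ * expI (-θ)) = unitJ := by
      rw [unitJ_mul_expI, neg_neg, h1]
    refine Matrix.ext fun i j => ?_
    fin_cases i <;> fin_cases j <;> simp [Matrix.mul_apply, Fin.sum_univ_three, h1, h2, mul_assoc]
    module
  · have h3 : expI (-θ) * (unitJ * (expI (-(2 * θ)) * unitJ)) = -expI θ := by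
      rw [← mul_assoc, expI_mul_unitJ_mul_expI_mul_unitJ]; congr 2; ring
    refine Matrix.ext fun i j => ?_
    fin_cases i <;> fin_cases j <;>
      simp [Matrix.mul_apply, Fin.sum_univ_three, mul_assoc, unitJ_mul_self, h3]

theorem exists_isSimple_mul_mul (A : SLH 3) {J : Matrix (Fin 3) (Fin 3) ℍ}
    (hJ : ∃ S₁ S₂ S₃, IsRealConj S₁ ∧ IsRealConj S₂ ∧ IsRealConj S₃ ∧ J = S₁ * S₂ * S₃)
    (hA : IsConj (A : Matrix (Fin 3) (Fin 3) ℍ) J) :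
    ∃ s₁ s₂ s₃ : SLH 3, IsSimple s₁ ∧ IsSimple s₂ ∧ IsSimple s₃ ∧ A = s₁ * s₂ * s₃ := by
  obtain ⟨S₁, S₂, S₃, h₁, h₂, h₃, rfl⟩ := hJ
  obtain ⟨l, hl, hs, hp⟩ := exists_list_isSimple A [S₁, S₂, S₃] (by simp [h₁, h₂, h₃])
    (by simpa [mul_assoc] using hA)
  obtain ⟨s₁, s₂, s₃, rfl⟩ := List.length_eq_three.1 hl
  exact ⟨s₁, s₂, s₃, hs _ (by simp), hs _ (by simp), hs _ (by simp),
    by simpa [mul_assoc] using hp⟩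

end QuatSL

end

theorem theorem1p3 :
    (∀ A : QuatSL.SLH 3, ∃ s₁ s₂ s₃ s₄ : QuatSL.SLH 3,
      QuatSL.IsSimple s₁ ∧ QuatSL.IsSimple s₂ ∧ QuatSL.IsSimple s₃ ∧ QuatSL.IsSimple s₄ ∧
        A = s₁ * s₂ * s₃ * s₄) ∧
    (∀ (A : QuatSL.SLH 3) (θ φ ψ : ℝ),
      θ ∈ Set.Icc 0 Real.pi → φ ∈ Set.Icc 0 Real.pi → ψ ∈ Set.Icc 0 Real.pi →
      IsConj (A : Matrix (Fin 3) (Fin 3) (Quaternion ℝ))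
        !![QuatSL.expI θ, 0, 0; 0, QuatSL.expI φ, 0; 0, 0, QuatSL.expI ψ] →
      ∃ s₁ s₂ s₃ : QuatSL.SLH 3,
        QuatSL.IsSimple s₁ ∧ QuatSL.IsSimple s₂ ∧ QuatSL.IsSimple s₃ ∧ A = s₁ * s₂ * s₃) ∧
    (∀ (A : QuatSL.SLH 3) (θ ψ : ℝ),
      θ ∈ Set.Icc 0 Real.pi → ψ ∈ Set.Icc 0 Real.pi →
      IsConj (A : Matrix (Fin 3) (Fin 3) (Quaternion ℝ))
        !![QuatSL.expI θ, 1, 0; 0, QuatSL.expI θ, 0; 0, 0, QuatSL.expI ψ] →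
      ∃ s₁ s₂ s₃ : QuatSL.SLH 3,
        QuatSL.IsSimple s₁ ∧ QuatSL.IsSimple s₂ ∧ QuatSL.IsSimple s₃ ∧ A = s₁ * s₂ * s₃) := by
  refine ⟨fun A => ?_,
    fun A θ φ ψ _ _ _ hA =>
      QuatSL.exists_isSimple_mul_mul A (QuatSL.exists_three_factors_diag θ φ ψ) hA,
    fun A θ ψ _ _ hA =>
      QuatSL.exists_isSimple_mul_mul A (QuatSL.exists_three_factors_jordan θ ψ) hA⟩
  obtain ⟨S₁, S₂, S₃, S₄, h₁, h₂, h₃, h₄, hA⟩ := QuatSL.exists_four_factors A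
  obtain ⟨l, hl, hs, hp⟩ := QuatSL.exists_list_isSimple A [S₁, S₂, S₃, S₄]
    (by simp [h₁, h₂, h₃, h₄]) (by simpa [mul_assoc] using hA)
  match l, hl with
  | [s₁, s₂, s₃, s₄], _ =>
    exact ⟨s₁, s₂, s₃, s₄, hs _ (by simp), hs _ (by simp), hs _ (by simp), hs _ (by simp),
      by simpa [mul_assoc] using hp⟩
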